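/- Let $k$ be a field, $R = k[x,y,z]$ with its standard grading, and $m = (x,y,z)$. An ideal $G$ of $R$ is called Gorenstein (respectively Cohen–Macaulay) if the ring $R/G$ is, and a complete intersection ideal is an ideal generated by a regular sequence. Two proper homogeneous Cohen–Macaulay ideals $I, J$ of $R$ are homogeneously G-linked, written $I \sim_G J$, if there is a homogeneous Gorenstein ideal $G$ with $G :_R I = J$ and $G :_R J = I$. An ideal $I$ is homogeneously glicci if there is a finite chain of homogeneous G-links $I = I_0 \sim_{G_0} I_1 \sim_{G_1} \cdots \sim_{G_{l-1}} I_l$ (with $l \ge 0$) in which $I_l$ is a homogeneous complete intersection ideal. **Theorem 3.1.** Let $I \subset R$ be an $m$-primary monomial ideal that can be generated by at most eight elements. Then $I$ is homogeneously glicci. Moreover, the chain can be chosen with monomial ideals in every second step: there are $s \ge 0$ and homogeneous G-links $I = I_0 \sim_{G_0} I_1 \sim_{G_1} \cdots \sim_{G_{2s-1}} I_{2s}$ such that $I_{2s}$ is a complete intersection ideal and each of $I_0, I_2, I_4, \dots, I_{2s}$ is an $m$-primary monomial ideal. -/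

import Mathlib

universe u v

/-- A (commutative) ring is Gorenstein if it is Noetherian and each of its localizations at a
maximal ideal has finite injective dimension as a module over itself. -/
def IsGorensteinRing (A : Type u) [CommRing A] : Prop :=
  IsNoetherianRing A ∧
    ∀ (p : Ideal A) [p.IsMaximal], ∃ d : ℕ,
      CategoryTheory.HasInjectiveDimensionLE
        (ModuleCat.of (Localization.AtPrime p) (Localization.AtPrime p)) d

/-- A (commutative) ring is Cohen-Macaulay if it is Noetherian and each of its localizations at a
maximal ideal has a regular sequence whose length is the Krull dimension of that localization.
(`IsRegular` forces the members of the sequence to lie in the maximal ideal.) -/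
def IsCohenMacaulayRing (A : Type u) [CommRing A] : Prop :=
  IsNoetherianRing A ∧
    ∀ (p : Ideal A) [p.IsMaximal], ∃ rs : List (Localization.AtPrime p),
      RingTheory.Sequence.IsRegular (Localization.AtPrime p) rs ∧
        (rs.length : WithBot ℕ∞) = ringKrullDim (Localization.AtPrime p)

/-- An ideal `I` of `A` is a Gorenstein ideal if `A ⧸ I` is a Gorenstein ring. -/
def IsGorensteinIdeal {A : Type u} [CommRing A] (I : Ideal A) : Prop :=
  IsGorensteinRing (A ⧸ I)

/-- An ideal `I` of `A` is a Cohen-Macaulay ideal if `A ⧸ I` is a Cohen-Macaulay ring. -/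
def IsCohenMacaulayIdeal {A : Type u} [CommRing A] (I : Ideal A) : Prop :=
  IsCohenMacaulayRing (A ⧸ I)

/-- A complete intersection ideal: an ideal generated by a regular sequence. -/
def IsCompleteIntersectionIdeal {A : Type u} [CommRing A] (I : Ideal A) : Prop :=
  ∃ rs : List A, RingTheory.Sequence.IsRegular A rs ∧ I = Ideal.ofList rs

/-- Homogeneity of an ideal of a polynomial ring, for the standard grading by total degree. -/
def IsHomogeneousIdeal {σ : Type v} {k : Type u} [Field k] (I : Ideal (MvPolynomial σ k)) : Prop :=
  letI : GradedAlgebra (MvPolynomial.homogeneousSubmodule σ k) := MvPolynomial.gradedAlgebra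
  I.IsHomogeneous (MvPolynomial.homogeneousSubmodule σ k)

/-- A monomial ideal: an ideal generated by monomials. -/
def IsMonomialIdeal {σ : Type v} {k : Type u} [Field k] (I : Ideal (MvPolynomial σ k)) : Prop :=
  ∃ S : Set (σ →₀ ℕ), I = Ideal.span ((fun a => MvPolynomial.monomial a (1 : k)) '' S)

/-- An `m`-primary ideal, where `m` is the ideal generated by the variables. -/
def IsVarsPrimary {σ : Type v} {k : Type u} [Field k] (I : Ideal (MvPolynomial σ k)) : Prop :=
  I.IsPrimary ∧ I.radical = MvPolynomial.idealOfVars σ k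

/-- `I` and `J` are homogeneously (directly) G-linked: they are proper homogeneous Cohen-Macaulay
ideals, and there is a homogeneous Gorenstein ideal `G` with `G : I = J` and `G : J = I`. -/
def IsHomogeneouslyGLinked {σ : Type v} {k : Type u} [Field k]
    (I J : Ideal (MvPolynomial σ k)) : Prop :=
  I ≠ ⊤ ∧ J ≠ ⊤ ∧ IsCohenMacaulayIdeal I ∧ IsCohenMacaulayIdeal J ∧
    IsHomogeneousIdeal I ∧ IsHomogeneousIdeal J ∧
    ∃ G : Ideal (MvPolynomial σ k), IsHomogeneousIdeal G ∧ IsGorensteinIdeal G ∧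
      Submodule.colon G (I : Set (MvPolynomial σ k)) = J ∧
      Submodule.colon G (J : Set (MvPolynomial σ k)) = I

/-- `L 0, L 1, …, L n` is a chain of homogeneous G-links from `I` to a homogeneous complete
intersection ideal. (The values `L i` with `i > n` play no role.) -/
def IsHomogeneousGlicciChain {σ : Type v} {k : Type u} [Field k]
    (I : Ideal (MvPolynomial σ k)) (n : ℕ) (L : ℕ → Ideal (MvPolynomial σ k)) : Prop :=
  L 0 = I ∧ (∀ i < n, IsHomogeneouslyGLinked (L i) (L (i + 1))) ∧
    IsHomogeneousIdeal (L n) ∧ IsCompleteIntersectionIdeal (L n)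

/-- `I` is homogeneously glicci: it is in the homogeneous G-linkage class of a complete
intersection ideal. -/
def IsHomogeneouslyGlicci {σ : Type v} {k : Type u} [Field k]
    (I : Ideal (MvPolynomial σ k)) : Prop :=
  ∃ (n : ℕ) (L : ℕ → Ideal (MvPolynomial σ k)), IsHomogeneousGlicciChain I n L

section

open MvPolynomial

/-! The ideal is enlarged step by step: for a suitable variable `z` outside `I`, replace `I` by `I :
z`. This is again monomial, m-primary and generated by at most eight monomials, and it is strictly
larger, so by Noetherianity the process stops, at m itself, which is a complete intersection. It
remains to join `I` to `I : z` by pairs of G-links.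

Gorenstein ideals are obtained as Macaulay inverse systems: `annIdeal φ` for a functional `φ`
concentrated in one degree. Suppose such a `G` and a monomial `u` satisfy `G ⊆ I ⊆ G + (u)`. Then `I
= G + u (I : u)`, hence `G : I = (G : u) : (I : u)`, and `G : u` is the inverse system of `φ`
composed with multiplication by `u`. So `I` and `I : u` are linked to one common ideal
(`IsHomogeneousFunctional.isDoublyLinked`). For `u = z` this asks for a Gorenstein `G` inside `I`
that agrees with `I` modulo `z`.

Three pure powers and two mixed generators for each pair of variables would make nine generators. So
for some `z` at most one generator involves exactly the other two variables `x, y`. If `I` is `(x^a,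
y^b)` modulo `z`, take `G = (x^a, y^b, z^(c+1))` with `z^c` in `I`. If it is `(x^a, x^i y^j, y^b)`,
pass to `S = x^t I + (y^B, z^C)`, which is doubly linked to `I` through `u = x^t`. For large `t` and
`B` an explicit six-term inverse system serves `S`, and `S : z = x^t (I : z) + (y^B, z^(C-1))` is
doubly linked to `I : z`. -/

/-! ### Gorenstein and Cohen-Macaulay criteria for Artinian algebras. -/

theorem exists_eq_functional_mul {k A : Type*} [Field k] [CommRing A] [Algebra k A]
    [Module.Finite k A] (ψ : A →ₗ[k] k) (hψ : ∀ b, (∀ c, ψ (c * b) = 0) → b = 0)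
    (χ : A →ₗ[k] k) : ∃ b, ∀ c, χ c = ψ (c * b) := by
  let T : A →ₗ[k] Module.Dual k A :=
    (LinearMap.mul k A).flip.compr₂ ψ
  have hT : Function.Injective T := by
    rw [injective_iff_map_eq_zero]
    intro b hb
    refine hψ b fun c => ?_
    exact LinearMap.congr_fun hb c
  have hT' : Function.Surjective T :=
    (LinearMap.injective_iff_surjective_of_finrank_eq_finrank
      (Subspace.dual_finrank_eq (K := k) (V := A)).symm).1 hT
  obtain ⟨b, hb⟩ := hT' χ
  exact ⟨b, fun c => by rw [← hb]; rfl⟩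

/-- Baer's criterion: for `g : J → A`, extend `ψ ∘ g` to all of `A` and write it as `ψ (· * b)`.
Nondegeneracy of `ψ` then forces `g` to be multiplication by `b`. -/
theorem injective_self_of_functional {k : Type*} {A : Type u} [Field k] [CommRing A] [Algebra k A]
    [Module.Finite k A] (ψ : A →ₗ[k] k) (hψ : ∀ b, (∀ c, ψ (c * b) = 0) → b = 0) :
    Module.Injective A A := by
  refine Module.Baer.injective fun J g => ?_
  obtain ⟨χ, hχ⟩ := LinearMap.exists_extend
    (p := J.restrictScalars k) (ψ ∘ₗ (g.restrictScalars k : (J.restrictScalars k) →ₗ[k] A))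
  obtain ⟨b, hb⟩ := exists_eq_functional_mul ψ hψ χ
  refine ⟨LinearMap.mulLeft A b, fun x hx => ?_⟩
  rw [← sub_eq_zero]
  refine hψ _ fun c => ?_
  have h1 : χ (c * x) = ψ (g ⟨c * x, J.mul_mem_left c hx⟩) :=
    LinearMap.congr_fun hχ ⟨c * x, J.mul_mem_left c hx⟩
  have h2 : g ⟨c * x, J.mul_mem_left c hx⟩ = c * g ⟨x, hx⟩ :=
    g.map_smul c ⟨x, hx⟩
  rw [h2, hb] at h1
  rw [mul_sub, map_sub, ← h1, LinearMap.mulLeft_apply, sub_eq_zero]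
  congr 1; ring

theorem isGorensteinRing_of_functional {k : Type*} {A : Type u} [Field k] [CommRing A]
    [Algebra k A] [Module.Finite k A] [IsLocalRing A] (ψ : A →ₗ[k] k)
    (hψ : ∀ b, (∀ c, ψ (c * b) = 0) → b = 0) : IsGorensteinRing A := by
  have : IsArtinianRing A := IsArtinianRing.of_finite k A
  refine ⟨inferInstance, fun p hp => ⟨0, ?_⟩⟩
  have hu : p.primeCompl ≤ IsUnit.submonoid A := by
    intro a ha
    have ha' : a ∉ p := ha
    rw [IsLocalRing.eq_maximalIdeal hp] at ha'
    exact IsLocalRing.notMem_maximalIdeal.1 ha'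
  let f := (IsLocalization.atUnits A p.primeCompl (S := Localization.AtPrime p) hu)
  let f' := f.restrictScalars k
  have : Module.Finite k (Localization.AtPrime p) := Module.Finite.equiv f'.toLinearEquiv
  have hinj : Module.Injective (Localization.AtPrime p) (Localization.AtPrime p) := by
    refine injective_self_of_functional (ψ ∘ₗ f'.symm.toLinearMap) fun b hb => ?_
    have : f'.symm b = 0 := by
      refine hψ _ fun c => ?_
      have := hb (f' c)
      simpa using this
    simpa using this
  have := Module.injective_object_of_injective_module (Localization.AtPrime p)
    (Localization.AtPrime p)
  exact CategoryTheory.injective_iff_hasInjectiveDimensionLT_one.1 this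

theorem isCohenMacaulayRing_of_isArtinianRing {A : Type u} [CommRing A] [IsArtinianRing A] :
    IsCohenMacaulayRing A := by
  refine ⟨inferInstance, fun p hp => ⟨[], ?_, ?_⟩⟩
  · exact RingTheory.Sequence.IsRegular.nil _ _
  · have : IsArtinianRing (Localization.AtPrime p) := inferInstance
    rw [ringKrullDimZero_iff_ringKrullDim_eq_zero.1 inferInstance]
    rfl

/-! ### Ideals containing a power of m, and inverse systems. -/

section

variable {σ : Type v} {k : Type u} [Field k]

theorem isMaximal_idealOfVars : (idealOfVars σ k).IsMaximal := by
  have h : idealOfVars σ k = RingHom.ker (constantCoeff (σ := σ) (R := k)) := by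
    ext p
    rw [← pow_one (idealOfVars σ k), mem_pow_idealOfVars_iff', RingHom.mem_ker,
      constantCoeff_eq]
    constructor
    · intro h; exact h 0 (by simp)
    · intro h x hx
      have : x = 0 := by
        rw [← Finsupp.degree_eq_zero_iff]; simpa using hx
      rw [this, h]
  rw [h]
  exact RingHom.ker_isMaximal_of_surjective _ fun c => ⟨C c, by simp⟩

theorem eq_idealOfVars_of_pow_le {N : ℕ} {p : Ideal (MvPolynomial σ k)} [hp : p.IsPrime]
    (h : idealOfVars σ k ^ N ≤ p) : p = idealOfVars σ k :=
  (isMaximal_idealOfVars.eq_of_le hp.ne_top (hp.le_of_pow_le h)).symm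

theorem finite_quotient [Finite σ] {N : ℕ} {I : Ideal (MvPolynomial σ k)}
    (h : idealOfVars σ k ^ N ≤ I) : Module.Finite k (MvPolynomial σ k ⧸ I) := by
  rw [Module.finite_iff_isArtinianRing k, isArtinianRing_iff_isNoetherianRing_krullDimLE_zero]
  refine ⟨inferInstance, Ring.krullDimLE_zero_iff.2 fun p hp => ?_⟩
  have h1 : p.comap (Ideal.Quotient.mk I) = idealOfVars σ k :=
    eq_idealOfVars_of_pow_le (N := N)
      (h.trans fun x hx => by simp [Ideal.mem_comap, Ideal.Quotient.eq_zero_iff_mem.2 hx])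
  have h2 : p = (idealOfVars σ k).map (Ideal.Quotient.mk I) := by
    rw [← h1, Ideal.map_comap_of_surjective _ Ideal.Quotient.mk_surjective]
  have := isMaximal_idealOfVars (σ := σ) (k := k)
  refine (Ideal.map_eq_top_or_isMaximal_of_surjective _
    Ideal.Quotient.mk_surjective this).resolve_left ?_ |> (h2 ▸ ·)
  rw [← h2]; exact hp.ne_top

theorem isLocalRing_quotient {N : ℕ} {I : Ideal (MvPolynomial σ k)}
    (h : idealOfVars σ k ^ N ≤ I) (hI : I ≠ ⊤) : IsLocalRing (MvPolynomial σ k ⧸ I) := by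
  have := Ideal.Quotient.nontrivial_iff.2 hI
  obtain ⟨M, hM⟩ := Ideal.exists_maximal (MvPolynomial σ k ⧸ I)
  refine IsLocalRing.of_unique_max_ideal ⟨M, hM, fun M' hM' => ?_⟩
  have key : ∀ p : Ideal (MvPolynomial σ k ⧸ I), p.IsMaximal →
      p = (idealOfVars σ k).map (Ideal.Quotient.mk I) := by
    intro p hp
    have h1 : p.comap (Ideal.Quotient.mk I) = idealOfVars σ k :=
      eq_idealOfVars_of_pow_le (N := N)
        (h.trans fun x hx => by simp [Ideal.mem_comap, Ideal.Quotient.eq_zero_iff_mem.2 hx])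
    rw [← h1, Ideal.map_comap_of_surjective _ Ideal.Quotient.mk_surjective]
  rw [key M hM, key M' hM']

theorem isCohenMacaulayIdeal_of_pow_le [Finite σ] {N : ℕ} {I : Ideal (MvPolynomial σ k)}
    (h : idealOfVars σ k ^ N ≤ I) : IsCohenMacaulayIdeal I := by
  have := finite_quotient h
  have : IsArtinianRing (MvPolynomial σ k ⧸ I) := IsArtinianRing.of_finite k _
  exact isCohenMacaulayRing_of_isArtinianRing

/-- The largest ideal contained in the kernel of a linear functional. -/
def annIdeal (φ : MvPolynomial σ k →ₗ[k] k) : Ideal (MvPolynomial σ k) where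
  carrier := {r | ∀ s, φ (s * r) = 0}
  add_mem' ha hb s := by rw [mul_add, map_add, ha s, hb s, add_zero]
  zero_mem' s := by simp
  smul_mem' c r hr s := by
    have := hr (s * c)
    rwa [mul_assoc] at this

theorem mem_annIdeal {φ : MvPolynomial σ k →ₗ[k] k} {r : MvPolynomial σ k} :
    r ∈ annIdeal φ ↔ ∀ s, φ (s * r) = 0 := Iff.rfl

theorem mem_annIdeal_iff_monomial {φ : MvPolynomial σ k →ₗ[k] k} {r : MvPolynomial σ k} :
    r ∈ annIdeal φ ↔ ∀ n, φ (monomial n 1 * r) = 0 := by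
  refine ⟨fun h n => h _, fun h s => ?_⟩
  induction s using MvPolynomial.induction_on' with
  | monomial n c =>
    have : monomial n c = c • (monomial n (1 : k)) := by rw [smul_monomial, smul_eq_mul, mul_one]
    rw [this, smul_mul_assoc, map_smul, h n, smul_zero]
  | add p q hp hq => rw [add_mul, map_add, hp, hq, add_zero]

/-- A linear functional on polynomials that vanishes on monomials of degree other than `e`. -/
def IsHomogeneousFunctional (φ : MvPolynomial σ k →ₗ[k] k) (e : ℕ) : Prop :=
  ∀ n : σ →₀ ℕ, n.degree ≠ e → φ (monomial n 1) = 0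

/-- The truncated subtraction is harmless: if `u` has degree above `e`, the composite vanishes on
every monomial. -/
theorem IsHomogeneousFunctional.comp_monomial {φ : MvPolynomial σ k →ₗ[k] k} {e : ℕ}
    (h : IsHomogeneousFunctional φ e) (u : σ →₀ ℕ) :
    IsHomogeneousFunctional (φ ∘ₗ LinearMap.mulLeft k (monomial u 1)) (e - u.degree) := by
  intro n hn
  rw [LinearMap.comp_apply, LinearMap.mulLeft_apply, monomial_mul, one_mul]
  refine h _ ?_
  rw [map_add]
  intro h'
  omega

theorem IsHomogeneousFunctional.pow_le {φ : MvPolynomial σ k →ₗ[k] k} {e : ℕ}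
    (h : IsHomogeneousFunctional φ e) : idealOfVars σ k ^ (e + 1) ≤ annIdeal φ := by
  intro r hr s
  have hsr : s * r ∈ idealOfVars σ k ^ (e + 1) := Ideal.mul_mem_left _ _ hr
  rw [mem_pow_idealOfVars_iff] at hsr
  rw [(s * r).as_sum, map_sum]
  refine Finset.sum_eq_zero fun n hn => ?_
  have : monomial n (coeff n (s * r)) = coeff n (s * r) • (monomial n (1 : k)) := by
    rw [smul_monomial, smul_eq_mul, mul_one]
  rw [this, map_smul, h n, smul_zero]
  have := hsr n hn
  omega

theorem isHomogeneousIdeal_iff {I : Ideal (MvPolynomial σ k)} :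
    IsHomogeneousIdeal I ↔ ∀ p ∈ I, ∀ d, homogeneousComponent d p ∈ I := by
  unfold IsHomogeneousIdeal
  constructor
  · intro h p hp d
    have := h d hp
    rwa [← decomposition.decompose'_apply]
  · intro h d p hp
    have := h p hp d
    rwa [← decomposition.decompose'_apply] at this

theorem IsHomogeneousFunctional.isHomogeneousIdeal {φ : MvPolynomial σ k →ₗ[k] k} {e : ℕ}
    (h : IsHomogeneousFunctional φ e) : IsHomogeneousIdeal (annIdeal φ) := by
  rw [isHomogeneousIdeal_iff]
  intro p hp d
  rw [mem_annIdeal_iff_monomial]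
  intro n
  have key : ∀ q : MvPolynomial σ k, φ (monomial n 1 * homogeneousComponent d q) =
      if n.degree + d = e then φ (monomial n 1 * q) else 0 := by
    intro q
    induction q using MvPolynomial.induction_on' with
    | monomial m c =>
      have hc : monomial n (1 : k) * monomial m c = c • (monomial (n + m) (1 : k)) := by
        rw [monomial_mul, smul_monomial, smul_eq_mul, one_mul, mul_one]
      by_cases hm : m.degree = d
      · rw [homogeneousComponent_of_mem (isHomogeneous_monomial c hm), if_pos rfl]
        split_ifs with hd
        · rfl
        · rw [hc, map_smul, h, smul_zero]
          rwa [map_add, hm]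
      · rw [homogeneousComponent_of_mem (isHomogeneous_monomial c rfl), if_neg (Ne.symm hm)]
        split_ifs with hd
        · rw [hc, map_smul, h, mul_zero, map_zero, smul_zero]
          rw [map_add]; omega
        · simp
    | add p q hp hq =>
      rw [map_add, mul_add, map_add, hp, hq]
      split_ifs <;> simp [mul_add]
  rw [key, hp]
  simp

end

/-! ### Links through inverse systems, monomial ideals, and double links. -/

section

variable {σ : Type v} {k : Type u} [Field k]

theorem exists_functional_quotient {A : Type*} [CommRing A] [Algebra k A] {G : Ideal A}
    {φ : A →ₗ[k] k} (h : ∀ g ∈ G, φ g = 0) :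
    ∃ ψ : A ⧸ G →ₗ[k] k, ∀ p, ψ (Ideal.Quotient.mk G p) = φ p := by
  obtain ⟨s, hs⟩ := LinearMap.exists_rightInverse_of_surjective
    (Ideal.Quotient.mkₐ k G).toLinearMap
    (LinearMap.range_eq_top.2 (Ideal.Quotient.mkₐ_surjective k G))
  refine ⟨φ ∘ₗ s, fun p => ?_⟩
  have h1 : Ideal.Quotient.mk G (s (Ideal.Quotient.mk G p)) = Ideal.Quotient.mk G p :=
    LinearMap.congr_fun hs (Ideal.Quotient.mk G p)
  have h2 := h _ (Ideal.Quotient.eq.1 h1)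
  rwa [map_sub, sub_eq_zero] at h2

theorem functional_eq_zero_of_mem_annIdeal {φ : MvPolynomial σ k →ₗ[k] k} {g : MvPolynomial σ k}
    (h : g ∈ annIdeal φ) : φ g = 0 := by
  simpa using h 1

theorem mk_eq_zero_of_forall_functional {φ : MvPolynomial σ k →ₗ[k] k}
    {ψ : MvPolynomial σ k ⧸ annIdeal φ →ₗ[k] k}
    (hψ : ∀ p, ψ (Ideal.Quotient.mk _ p) = φ p) (b : MvPolynomial σ k ⧸ annIdeal φ)
    (hb : ∀ c, ψ (c * b) = 0) : b = 0 := by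
  obtain ⟨b, rfl⟩ := Ideal.Quotient.mk_surjective b
  rw [Ideal.Quotient.eq_zero_iff_mem]
  intro s
  rw [← hψ, map_mul]
  exact hb _

theorem IsHomogeneousFunctional.isGorensteinIdeal [Finite σ] {φ : MvPolynomial σ k →ₗ[k] k}
    {e : ℕ} (h : IsHomogeneousFunctional φ e) (hφ : annIdeal φ ≠ ⊤) :
    IsGorensteinIdeal (annIdeal φ) := by
  have := finite_quotient h.pow_le
  have := isLocalRing_quotient h.pow_le hφ
  obtain ⟨ψ, hψ⟩ := exists_functional_quotient (G := annIdeal φ) (φ := φ)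
    fun g hg => functional_eq_zero_of_mem_annIdeal hg
  exact isGorensteinRing_of_functional ψ (mk_eq_zero_of_forall_functional hψ)

theorem IsHomogeneousFunctional.exists_eq_mul [Finite σ] {φ : MvPolynomial σ k →ₗ[k] k}
    {e : ℕ} (h : IsHomogeneousFunctional φ e) {χ : MvPolynomial σ k →ₗ[k] k}
    (hχ : ∀ g ∈ annIdeal φ, χ g = 0) : ∃ s, ∀ p, χ p = φ (p * s) := by
  have := finite_quotient h.pow_le
  obtain ⟨ψ, hψ⟩ := exists_functional_quotient (G := annIdeal φ) (φ := φ)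
    fun g hg => functional_eq_zero_of_mem_annIdeal hg
  obtain ⟨χ', hχ'⟩ := exists_functional_quotient hχ
  obtain ⟨s, hs⟩ := exists_eq_functional_mul ψ (mk_eq_zero_of_forall_functional hψ) χ'
  obtain ⟨s, rfl⟩ := Ideal.Quotient.mk_surjective s
  exact ⟨s, fun p => by rw [← hχ', hs, ← map_mul, hψ]⟩

theorem mem_colon_annIdeal {φ : MvPolynomial σ k →ₗ[k] k} {I : Ideal (MvPolynomial σ k)}
    {r : MvPolynomial σ k} :
    r ∈ Submodule.colon (annIdeal φ) (I : Set (MvPolynomial σ k)) ↔ ∀ i ∈ I, φ (r * i) = 0 := by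
  rw [Submodule.mem_colon]
  refine ⟨fun h i hi => functional_eq_zero_of_mem_annIdeal (h i hi), fun h i hi s => ?_⟩
  rw [smul_eq_mul, mul_left_comm]
  exact h _ (I.mul_mem_left s hi)

/-- Duality over `R/G`: if `p ∉ I`, some functional kills `I` but not `p`. It kills `G`, so it is `φ
(· * s)`; then `s` lies in `G : I` while `φ (p * s) ≠ 0`. -/
theorem IsHomogeneousFunctional.colon_colon [Finite σ] {φ : MvPolynomial σ k →ₗ[k] k} {e : ℕ}
    (h : IsHomogeneousFunctional φ e) {I : Ideal (MvPolynomial σ k)} (hI : annIdeal φ ≤ I) :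
    Submodule.colon (annIdeal φ)
      (Submodule.colon (annIdeal φ) (I : Set (MvPolynomial σ k)) : Set (MvPolynomial σ k)) = I := by
  ext p
  rw [mem_colon_annIdeal]
  constructor
  · intro hp
    by_contra hpI
    obtain ⟨χ, hχ, hle⟩ := Submodule.exists_le_ker_of_notMem (p := I.restrictScalars k) hpI
    obtain ⟨s, hs⟩ := h.exists_eq_mul fun g hg => hle (hI hg)
    apply hχ
    rw [hs]
    refine hp s (mem_colon_annIdeal.2 fun i hi => ?_)
    rw [mul_comm, ← hs]
    exact hle hi
  · intro hp l hl
    rw [mul_comm]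
    exact mem_colon_annIdeal.1 hl p hp

/-- The ideal spanned by the monomials with exponent in `U`. -/
noncomputable def monIdeal (k : Type u) [Field k] (U : Set (σ →₀ ℕ)) : Ideal (MvPolynomial σ k) :=
  Ideal.span ((fun a => monomial a (1 : k)) '' U)

theorem mem_monIdeal {U : Set (σ →₀ ℕ)} (hU : IsUpperSet U) {p : MvPolynomial σ k} :
    p ∈ monIdeal k U ↔ ∀ n ∈ p.support, n ∈ U := by
  rw [monIdeal, mem_ideal_span_monomial_image]
  refine forall₂_congr fun n _ => ⟨fun ⟨m, hm, hmn⟩ => hU hmn hm, fun h => ⟨n, h, le_rfl⟩⟩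

theorem monomial_mem_monIdeal {U : Set (σ →₀ ℕ)} (hU : IsUpperSet U) {n : σ →₀ ℕ} :
    monomial n (1 : k) ∈ monIdeal k U ↔ n ∈ U := by
  classical
  rw [mem_monIdeal hU]
  simp [coeff_monomial]

/-- The exponent sets of the monomial ideals that are primary to the ideal of the variables. -/
structure IsPrimaryExponents (U : Set (σ →₀ ℕ)) : Prop where
  isUpperSet : IsUpperSet U
  zero_notMem : 0 ∉ U
  exists_single : ∀ i, ∃ N, Finsupp.single i N ∈ U

namespace IsPrimaryExponents

variable {U : Set (σ →₀ ℕ)}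

theorem exists_pow_le [Finite σ] (hU : IsPrimaryExponents U) :
    ∃ N, idealOfVars σ k ^ N ≤ monIdeal k U := by
  have := Fintype.ofFinite σ
  choose N hN using hU.exists_single
  refine ⟨∑ i, N i + 1, fun p hp => (mem_monIdeal hU.isUpperSet).2 fun n hn => ?_⟩
  have h1 := (mem_pow_idealOfVars_iff _ p).1 hp n hn
  obtain ⟨i, hi⟩ : ∃ i, N i ≤ n i := by
    by_contra! hlt
    have := Finset.sum_le_sum fun i (_ : i ∈ Finset.univ) => (hlt i).le
    rw [Finsupp.degree_eq_sum] at h1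
    omega
  refine hU.isUpperSet ?_ (hN i)
  rwa [Finsupp.single_le_iff]

theorem monIdeal_le (hU : IsPrimaryExponents U) : monIdeal k U ≤ idealOfVars σ k := by
  intro p hp
  rw [← pow_one (idealOfVars σ k), mem_pow_idealOfVars_iff]
  intro n hn
  have := (mem_monIdeal hU.isUpperSet).1 hp n hn
  by_contra h
  have : n = 0 := by rw [← Finsupp.degree_eq_zero_iff]; omega
  subst this
  exact hU.zero_notMem ‹_›

theorem ne_top (hU : IsPrimaryExponents U) : monIdeal k U ≠ ⊤ := fun h =>
  (isMaximal_idealOfVars (σ := σ) (k := k)).ne_top (top_le_iff.1 (h ▸ hU.monIdeal_le))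

theorem isVarsPrimary [Finite σ] (hU : IsPrimaryExponents U) : IsVarsPrimary (monIdeal k U) := by
  have hmax := isMaximal_idealOfVars (σ := σ) (k := k)
  have hrad : (monIdeal k U).radical = idealOfVars σ k := by
    refine le_antisymm ((Ideal.radical_mono hU.monIdeal_le).trans hmax.isPrime.radical.le) ?_
    obtain ⟨N, hN⟩ := hU.exists_pow_le (k := k)
    exact fun x hx => ⟨N, hN (Ideal.pow_mem_pow hx N)⟩
  exact ⟨Ideal.isPrimary_of_isMaximal_radical (hrad ▸ hmax), hrad⟩

theorem colon (hU : IsPrimaryExponents U) {u : σ →₀ ℕ} (hu : u ∉ U) :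
    IsPrimaryExponents {n | n + u ∈ U} where
  isUpperSet _ _ hab ha := hU.isUpperSet (add_le_add_left hab u) ha
  zero_notMem := by simpa using hu
  exists_single i := by
    obtain ⟨N, hN⟩ := hU.exists_single i
    exact ⟨N, hU.isUpperSet le_self_add hN⟩

theorem isHomogeneousIdeal (hU : IsPrimaryExponents U) : IsHomogeneousIdeal (monIdeal k U) := by
  rw [isHomogeneousIdeal_iff]
  intro p hp d
  rw [mem_monIdeal hU.isUpperSet] at hp ⊢
  intro n hn
  refine hp n ?_
  rw [mem_support_iff, coeff_homogeneousComponent] at hn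
  rw [mem_support_iff]
  exact fun h => hn (by rw [h, ite_self])

end IsPrimaryExponents

theorem IsHomogeneouslyGLinked.symm {I J : Ideal (MvPolynomial σ k)}
    (h : IsHomogeneouslyGLinked I J) : IsHomogeneouslyGLinked J I := by
  obtain ⟨h1, h2, h3, h4, h5, h6, G, h7, h8, h9, h10⟩ := h
  exact ⟨h2, h1, h4, h3, h6, h5, G, h7, h8, h10, h9⟩

theorem IsHomogeneousFunctional.isHomogeneouslyGLinked [Finite σ] {U : Set (σ →₀ ℕ)}
    (hU : IsPrimaryExponents U) {φ : MvPolynomial σ k →ₗ[k] k} {e : ℕ}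
    (h : IsHomogeneousFunctional φ e) (hG : annIdeal φ ≤ monIdeal k U)
    (hne : ¬ monIdeal k U ≤ annIdeal φ) :
    IsHomogeneouslyGLinked (monIdeal k U)
      (Submodule.colon (annIdeal φ) (monIdeal k U : Set (MvPolynomial σ k))) := by
  obtain ⟨N, hN⟩ := hU.exists_pow_le (k := k)
  refine ⟨hU.ne_top, fun htop => hne fun x hx => ?_, isCohenMacaulayIdeal_of_pow_le hN,
    isCohenMacaulayIdeal_of_pow_le (h.pow_le.trans fun x hx => ?_), hU.isHomogeneousIdeal, ?_,
    annIdeal φ, h.isHomogeneousIdeal,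
    h.isGorensteinIdeal fun htop => hU.ne_top (top_le_iff.1 (htop ▸ hG)), rfl, h.colon_colon hG⟩
  · have h1 := htop ▸ Submodule.mem_top (x := (1 : MvPolynomial σ k))
    simpa using Submodule.mem_colon.1 h1 x hx
  · exact Submodule.mem_colon.2 fun y _ => Ideal.mul_mem_right y _ hx
  -- The colon ideal is the intersection of the inverse systems of `φ` composed with the monomials
  -- of `I`, each of which is homogeneous.
  · have key : ∀ p, p ∈ Submodule.colon (annIdeal φ) (monIdeal k U : Set (MvPolynomial σ k)) ↔
        ∀ n ∈ U, p ∈ annIdeal (φ ∘ₗ LinearMap.mulLeft k (monomial n 1)) := by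
      intro p
      have h0 : p ∈ Submodule.colon (annIdeal φ) (monIdeal k U : Set (MvPolynomial σ k)) ↔
          monIdeal k U ≤ (annIdeal φ).colon {p} := by
        rw [Submodule.mem_colon]
        exact forall₂_congr fun x _ => by
          rw [Submodule.mem_colon_singleton, smul_eq_mul, smul_eq_mul, mul_comm]
      rw [h0, monIdeal, Ideal.span_le, Set.image_subset_iff]
      refine forall₂_congr fun n _ => ?_
      rw [Set.mem_preimage, SetLike.mem_coe, Submodule.mem_colon_singleton, mem_annIdeal,
        mem_annIdeal]
      refine forall_congr' fun s => ?_
      rw [LinearMap.comp_apply, LinearMap.mulLeft_apply, smul_eq_mul, mul_left_comm]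
    rw [isHomogeneousIdeal_iff]
    intro p hp d
    rw [key] at hp ⊢
    exact fun n hn => isHomogeneousIdeal_iff.1 (h.comp_monomial n).isHomogeneousIdeal p (hp n hn) d

/-- Two monomial ideals, given by their sets of exponents, that are joined by two links. -/
def IsDoublyLinked (k : Type u) [Field k] (U V : Set (σ →₀ ℕ)) : Prop :=
  IsPrimaryExponents U ∧ IsPrimaryExponents V ∧ ∃ L : Ideal (MvPolynomial σ k),
    IsHomogeneouslyGLinked (monIdeal k U) L ∧ IsHomogeneouslyGLinked L (monIdeal k V)

theorem IsDoublyLinked.symm {U V : Set (σ →₀ ℕ)} (h : IsDoublyLinked k U V) :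
    IsDoublyLinked k V U := by
  obtain ⟨hU, hV, L, h1, h2⟩ := h
  exact ⟨hV, hU, L, h2.symm, h1.symm⟩

/-- The common link is `G : I = (G : u) : (I : u)`. Both `hsup`, which says `I ⊆ G + (u)`, and `G ⊆
I` enter through the decomposition `I = G + u (I : u)`. The condition `hne` keeps the link a proper
ideal. -/
theorem IsHomogeneousFunctional.isDoublyLinked [Finite σ] {U : Set (σ →₀ ℕ)}
    (hU : IsPrimaryExponents U) {φ : MvPolynomial σ k →ₗ[k] k} {e : ℕ}
    (h : IsHomogeneousFunctional φ e) (hG : annIdeal φ ≤ monIdeal k U) {u : σ →₀ ℕ} (hu : u ∉ U)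
    (hne : ∃ n ∈ U, monomial n (1 : k) ∉ annIdeal φ)
    (hsup : ∀ n ∈ U, ∃ g ∈ annIdeal φ, ∃ p, monomial n (1 : k) = g + monomial u 1 * p) :
    IsDoublyLinked k U {n | n + u ∈ U} := by
  have hV := hU.colon hu
  set V : Set (σ →₀ ℕ) := {n | n + u ∈ U} with hVdef
  have hmemV : ∀ p, p ∈ monIdeal k V ↔ monomial u 1 * p ∈ monIdeal k U := by
    intro p
    rw [mem_monIdeal hV.isUpperSet, mem_monIdeal hU.isUpperSet]
    constructor
    · intro hp n hn
      rw [mem_support_iff, coeff_monomial_mul'] at hn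
      split_ifs at hn with hun
      · have := hp (n - u) (mem_support_iff.2 fun h => hn (by rw [h, mul_zero]))
        rwa [hVdef, Set.mem_ofPred_eq, tsub_add_cancel_of_le hun] at this
      · exact absurd rfl hn
    · intro hp n hn
      rw [hVdef, Set.mem_ofPred_eq, add_comm]
      refine hp _ ?_
      rw [mem_support_iff, coeff_monomial_mul, one_mul]
      exact mem_support_iff.1 hn
  have hne' : ¬ monIdeal k U ≤ annIdeal φ := by
    obtain ⟨n, hn, hn'⟩ := hne
    exact fun hle => hn' (hle ((monomial_mem_monIdeal hU.isUpperSet).2 hn))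
  have hmemφ : ∀ p, p ∈ annIdeal (φ ∘ₗ LinearMap.mulLeft k (monomial u 1)) ↔
      monomial u 1 * p ∈ annIdeal φ := by
    intro p
    simp only [mem_annIdeal, LinearMap.comp_apply, LinearMap.mulLeft_apply]
    exact forall_congr' fun s => by rw [mul_left_comm]
  have hdec : ∀ x ∈ monIdeal k U, ∃ g ∈ annIdeal φ, ∃ p ∈ monIdeal k V,
      x = g + monomial u 1 * p := by
    have hle : monIdeal k U ≤ annIdeal φ ⊔ Ideal.span {monomial u (1 : k)} := by
      rw [monIdeal, Ideal.span_le, Set.image_subset_iff]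
      intro n hn
      obtain ⟨g, hg, p, hp⟩ := hsup n hn
      rw [Set.mem_preimage, hp]
      exact Submodule.add_mem_sup hg (Ideal.mul_mem_right _ _ (Ideal.mem_span_singleton_self _))
    intro x hx
    obtain ⟨g, hg, y, hy, rfl⟩ := Submodule.mem_sup.1 (hle hx)
    obtain ⟨p, rfl⟩ := Ideal.mem_span_singleton.1 hy
    refine ⟨g, hg, p, (hmemV p).2 ?_, rfl⟩
    simpa using sub_mem hx (hG hg)
  have hG' : annIdeal (φ ∘ₗ LinearMap.mulLeft k (monomial u 1)) ≤ monIdeal k V :=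
    fun p hp => (hmemV p).2 (hG ((hmemφ p).1 hp))
  have hneV : ¬ monIdeal k V ≤ annIdeal (φ ∘ₗ LinearMap.mulLeft k (monomial u 1)) := by
    intro hle
    refine hne' fun x hx => ?_
    obtain ⟨g, hg, p, hp, rfl⟩ := hdec x hx
    exact add_mem hg ((hmemφ p).1 (hle hp))
  have hL : Submodule.colon (annIdeal (φ ∘ₗ LinearMap.mulLeft k (monomial u 1)))
      (monIdeal k V : Set (MvPolynomial σ k)) =
      Submodule.colon (annIdeal φ) (monIdeal k U : Set (MvPolynomial σ k)) := by
    ext r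
    simp only [mem_colon_annIdeal, LinearMap.comp_apply, LinearMap.mulLeft_apply]
    constructor
    · intro hr x hx
      obtain ⟨g, hg, p, hp, rfl⟩ := hdec x hx
      rw [mul_add, map_add, hg r, zero_add, mul_left_comm]
      exact hr p hp
    · intro hr p hp
      rw [mul_left_comm]
      exact hr _ ((hmemV p).1 hp)
  refine ⟨hU, hV, _, h.isHomogeneouslyGLinked hU hG hne', ?_⟩
  rw [← hL]
  exact ((h.comp_monomial u).isHomogeneouslyGLinked hV hG' hneV).symm

theorem exists_chain_of_reflTransGen [Finite σ] {U V : Set (σ →₀ ℕ)}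
    (h : Relation.ReflTransGen (IsDoublyLinked k) U V) (hV : IsPrimaryExponents V)
    (hci : IsCompleteIntersectionIdeal (monIdeal k V)) :
    ∃ (s : ℕ) (L : ℕ → Ideal (MvPolynomial σ k)),
      IsHomogeneousGlicciChain (monIdeal k U) (2 * s) L ∧
        ∀ j ≤ s, IsVarsPrimary (L (2 * j)) ∧ IsMonomialIdeal (L (2 * j)) := by
  induction h using Relation.ReflTransGen.head_induction_on with
  | refl =>
    refine ⟨0, fun _ => monIdeal k V, ⟨rfl, fun i hi => absurd hi (by simp),
      hV.isHomogeneousIdeal, hci⟩, fun j _ => ⟨hV.isVarsPrimary, V, rfl⟩⟩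
  | @head W _ hstep _ ih =>
    obtain ⟨hW, -, M, h1, h2⟩ := hstep
    obtain ⟨s, L, ⟨hL0, hL, hhom, hL'⟩, hmon⟩ := ih
    let L₁ : ℕ → Ideal (MvPolynomial σ k)
      | 0 => monIdeal k W
      | 1 => M
      | n + 2 => L n
    refine ⟨s + 1, L₁, ⟨rfl, ?_, hhom, hL'⟩, ?_⟩
    · rintro (_ | _ | i) hi
      · exact h1
      · change IsHomogeneouslyGLinked M (L 0)
        rwa [hL0]
      · exact hL i (by omega)
    · rintro (_ | j) hj
      · exact ⟨hW.isVarsPrimary, W, rfl⟩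
      · exact hmon j (by omega)

end

/-! ### Three variables up to permutation; links with monomial inverse systems. -/

section

variable {k : Type u} [Field k]

/-- The exponent with coordinates `a, b, c`, the variables being ordered by `π`. -/
noncomputable def expOf (π : Equiv.Perm (Fin 3)) (a b c : ℕ) : Fin 3 →₀ ℕ :=
  Finsupp.single (π 0) a + Finsupp.single (π 1) b + Finsupp.single (π 2) c

variable (π : Equiv.Perm (Fin 3))

@[simp] theorem expOf_apply_zero (a b c : ℕ) : expOf π a b c (π 0) = a := by
  simp [expOf]

@[simp] theorem expOf_apply_one (a b c : ℕ) : expOf π a b c (π 1) = b := by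
  simp [expOf]

@[simp] theorem expOf_apply_two (a b c : ℕ) : expOf π a b c (π 2) = c := by
  simp [expOf]

theorem forall_perm_fin_three {P : Fin 3 → Prop} :
    (∀ i, P i) ↔ P (π 0) ∧ P (π 1) ∧ P (π 2) := by
  rw [← π.forall_congr_right, Fin.forall_fin_succ, Fin.forall_fin_two]
  rfl

theorem exp_ext {m n : Fin 3 →₀ ℕ} (h0 : m (π 0) = n (π 0)) (h1 : m (π 1) = n (π 1))
    (h2 : m (π 2) = n (π 2)) : m = n :=
  Finsupp.ext ((forall_perm_fin_three π).2 ⟨h0, h1, h2⟩)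

theorem exp_le_iff {m n : Fin 3 →₀ ℕ} :
    m ≤ n ↔ m (π 0) ≤ n (π 0) ∧ m (π 1) ≤ n (π 1) ∧ m (π 2) ≤ n (π 2) := by
  rw [Finsupp.le_def, forall_perm_fin_three π]

theorem single_zero_eq (a : ℕ) : Finsupp.single (π 0) a = expOf π a 0 0 := by simp [expOf]

theorem single_one_eq (a : ℕ) : Finsupp.single (π 1) a = expOf π 0 a 0 := by simp [expOf]

theorem single_two_eq (a : ℕ) : Finsupp.single (π 2) a = expOf π 0 0 a := by simp [expOf]

theorem expOf_zero : expOf π 0 0 0 = 0 := by simp [expOf]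

theorem degree_expOf (a b c : ℕ) : (expOf π a b c).degree = a + b + c := by
  simp [expOf]

theorem coeff_expOf_mul {a b c α β γ : ℕ} (h : a ≤ α ∧ b ≤ β ∧ c ≤ γ)
    (p : MvPolynomial (Fin 3) k) :
    coeff (expOf π α β γ) (monomial (expOf π a b c) 1 * p) =
      coeff (expOf π (α - a) (β - b) (γ - c)) p := by
  rw [coeff_monomial_mul', if_pos (by simpa [exp_le_iff π] using h), one_mul]
  congr 1
  apply exp_ext π <;> simp

theorem coeff_expOf_mul_eq_zero {a b c α β γ : ℕ} (h : α < a ∨ β < b ∨ γ < c)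
    (p : MvPolynomial (Fin 3) k) :
    coeff (expOf π α β γ) (monomial (expOf π a b c) 1 * p) = 0 := by
  rw [coeff_monomial_mul', if_neg]
  simp only [exp_le_iff π, expOf_apply_zero, expOf_apply_one, expOf_apply_two]
  omega

theorem isHomogeneousFunctional_lcoeff {σ : Type*} (n : σ →₀ ℕ) :
    IsHomogeneousFunctional (lcoeff k n) n.degree := by
  classical
  intro m hm
  rw [lcoeff_apply, coeff_monomial, if_neg]
  rintro rfl
  exact hm rfl

/-- It suffices to recover from `φ` the coefficients at a few corners `N` that dominate the
complement of `U`: multiplying by the monomial of exponent `N - n` moves the coefficient at `n` to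
`N`. -/
theorem annIdeal_le_monIdeal {σ : Type*} {U : Set (σ →₀ ℕ)} (hU : IsUpperSet U)
    {φ : MvPolynomial σ k →ₗ[k] k}
    (h : ∀ n ∉ U, ∃ N, n ≤ N ∧ ∃ s, ∀ p, coeff N p = φ (s * p)) :
    annIdeal φ ≤ monIdeal k U := by
  intro r hr
  rw [mem_monIdeal hU]
  intro n hn
  by_contra hnU
  obtain ⟨N, hN, s, hs⟩ := h n hnU
  have h1 := hs (monomial (N - n) 1 * r)
  rw [coeff_monomial_mul', if_pos tsub_le_self, tsub_tsub_cancel_of_le hN, one_mul, ← mul_assoc,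
    hr] at h1
  exact mem_support_iff.1 hn h1

theorem monomial_mem_annIdeal_lcoeff {σ : Type*} {n N : σ →₀ ℕ} (h : ¬ n ≤ N) :
    monomial n (1 : k) ∈ annIdeal (lcoeff k N) := by
  intro s
  rw [lcoeff_apply, coeff_mul_monomial', if_neg h]

theorem monomial_notMem_annIdeal_lcoeff {σ : Type*} {n N : σ →₀ ℕ} (h : n ≤ N) :
    monomial n (1 : k) ∉ annIdeal (lcoeff k N) := by
  classical
  intro hn
  have := hn (monomial (N - n) 1)
  rw [lcoeff_apply, monomial_mul, tsub_add_cancel_of_le h, coeff_monomial, if_pos rfl] at this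
  simp at this

theorem exists_eq_add_monomial_mul {σ : Type*} (I : Ideal (MvPolynomial σ k)) {u n : σ →₀ ℕ}
    (h : u ≤ n) : ∃ g ∈ I, ∃ p, monomial n (1 : k) = g + monomial u 1 * p :=
  ⟨0, I.zero_mem, monomial (n - u) 1, by
    rw [monomial_mul, zero_add, one_mul, add_tsub_cancel_of_le h]⟩

variable {π} {U : Set (Fin 3 →₀ ℕ)}

theorem isDoublyLinked_of_side_eq_two (hU : IsPrimaryExponents U) {a b : ℕ}
    (ha : expOf π a 0 0 ∈ U) (hb : expOf π 0 b 0 ∈ U) (hz : expOf π 0 0 1 ∉ U)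
    (hside : ∀ n ∈ U, n (π 2) = 0 → a ≤ n (π 0) ∨ b ≤ n (π 1)) :
    IsDoublyLinked k U {n | n + expOf π 0 0 1 ∈ U} := by
  obtain ⟨c, hc⟩ := hU.exists_single (π 2)
  rw [single_two_eq] at hc
  have ha0 : a ≠ 0 := by rintro rfl; exact hU.zero_notMem (expOf_zero π ▸ ha)
  have hb0 : b ≠ 0 := by rintro rfl; exact hU.zero_notMem (expOf_zero π ▸ hb)
  -- Here `G = (x^a, y^b, z^(c+1))`. The exponent `c` instead of `c - 1` keeps `z^c ∈ I` out of `G`,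
  -- so that `I` is not contained in `G`.
  refine (isHomogeneousFunctional_lcoeff (expOf π (a - 1) (b - 1) c)).isDoublyLinked hU
    (annIdeal_le_monIdeal hU.isUpperSet fun n hn => ⟨_, ?_, 1, fun p => by
      rw [one_mul, lcoeff_apply]⟩) hz
    ⟨_, hc, monomial_notMem_annIdeal_lcoeff (by simp [exp_le_iff π])⟩ fun n hn => ?_
  · have h1 : n (π 0) < a := by
      by_contra! h
      exact hn (hU.isUpperSet (by simpa [exp_le_iff π] using h) ha)
    have h2 : n (π 1) < b := by
      by_contra! h
      exact hn (hU.isUpperSet (by simpa [exp_le_iff π] using h) hb)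
    have h3 : n (π 2) < c := by
      by_contra! h
      exact hn (hU.isUpperSet (by simpa [exp_le_iff π] using h) hc)
    simp only [exp_le_iff π, expOf_apply_zero, expOf_apply_one, expOf_apply_two]
    omega
  · by_cases h0 : n (π 2) = 0
    · refine ⟨_, monomial_mem_annIdeal_lcoeff ?_, 0, by rw [mul_zero, add_zero]⟩
      have := hside n hn h0
      simp only [exp_le_iff π, expOf_apply_zero, expOf_apply_one, expOf_apply_two]
      omega
    · apply exists_eq_add_monomial_mul
      simp only [exp_le_iff π, expOf_apply_zero, expOf_apply_one, expOf_apply_two]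
      omega

/-- The exponent set of `x ^ t * I + (y ^ B, z ^ C)`, where `U` is the exponent set of `I`. -/
def shiftExponents (π : Equiv.Perm (Fin 3)) (t B C : ℕ) (U : Set (Fin 3 →₀ ℕ)) :
    Set (Fin 3 →₀ ℕ) :=
  {n | (t ≤ n (π 0) ∧ n - expOf π t 0 0 ∈ U) ∨ B ≤ n (π 1) ∨ C ≤ n (π 2)}

theorem mem_shiftExponents {t B C : ℕ} {n : Fin 3 →₀ ℕ} :
    n ∈ shiftExponents π t B C U ↔
      (t ≤ n (π 0) ∧ n - expOf π t 0 0 ∈ U) ∨ B ≤ n (π 1) ∨ C ≤ n (π 2) := Iff.rfl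

theorem IsPrimaryExponents.shiftExponents (hU : IsPrimaryExponents U) {t B C : ℕ} (hB : B ≠ 0)
    (hC : C ≠ 0) : IsPrimaryExponents (shiftExponents π t B C U) where
  isUpperSet m n hmn hm := by
    have hle := (exp_le_iff π).1 hmn
    rcases mem_shiftExponents.1 hm with ⟨h1, h2⟩ | h | h
    · exact Or.inl ⟨h1.trans hle.1, hU.isUpperSet (tsub_le_tsub_right hmn _) h2⟩
    · exact Or.inr (Or.inl (h.trans hle.2.1))
    · exact Or.inr (Or.inr (h.trans hle.2.2))
  zero_notMem h := by
    rcases mem_shiftExponents.1 h with ⟨-, h⟩ | h | h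
    · exact hU.zero_notMem (by simpa using h)
    · exact hB (by simpa using h)
    · exact hC (by simpa using h)
  exists_single := by
    rw [forall_perm_fin_three π]
    refine ⟨?_, ⟨B, ?_⟩, ⟨C, ?_⟩⟩
    · obtain ⟨N, hN⟩ := hU.exists_single (π 0)
      refine ⟨N + t, mem_shiftExponents.2 (Or.inl ⟨by simp, ?_⟩)⟩
      rw [single_zero_eq] at hN ⊢
      refine hU.isUpperSet ?_ hN
      simp [exp_le_iff π]
    · exact mem_shiftExponents.2 (Or.inr (Or.inl (by simp)))
    · exact mem_shiftExponents.2 (Or.inr (Or.inr (by simp)))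

/-- Double link with `u = x^t` and `G = (x^(a+t+1), y^B, z^C)`. Outside the multiples of `x^t` the
shifted ideal is just `(y^B, z^C)`, and its colon by `x^t` is `I` because `y^B, z^C ∈ I`. -/
theorem isDoublyLinked_shiftExponents (hU : IsPrimaryExponents U) {t B C : ℕ}
    (hB : expOf π 0 B 0 ∈ U) (hC : expOf π 0 0 C ∈ U) :
    IsDoublyLinked k (shiftExponents π t B C U) U := by
  have hB0 : B ≠ 0 := by rintro rfl; exact hU.zero_notMem (expOf_zero π ▸ hB)
  have hC0 : C ≠ 0 := by rintro rfl; exact hU.zero_notMem (expOf_zero π ▸ hC)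
  have hS := hU.shiftExponents (π := π) (t := t) hB0 hC0
  obtain ⟨a, ha⟩ := hU.exists_single (π 0)
  rw [single_zero_eq] at ha
  have hcolon : U = {n | n + expOf π t 0 0 ∈ shiftExponents π t B C U} := by
    ext n
    rw [Set.mem_ofPred_eq, mem_shiftExponents, add_tsub_cancel_right]
    simp only [Finsupp.add_apply, expOf_apply_zero, expOf_apply_one, expOf_apply_two, add_zero]
    refine ⟨fun h => Or.inl ⟨by omega, h⟩, ?_⟩
    rintro (⟨-, h⟩ | h | h)
    · exact h
    · exact hU.isUpperSet (by simpa [exp_le_iff π] using h) hB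
    · exact hU.isUpperSet (by simpa [exp_le_iff π] using h) hC
  have hu : expOf π t 0 0 ∉ shiftExponents π t B C U := by
    rw [mem_shiftExponents]
    simp [hU.zero_notMem, hB0, hC0]
  nth_rw 2 [hcolon]
  refine (isHomogeneousFunctional_lcoeff (expOf π (a + t) (B - 1) (C - 1))).isDoublyLinked hS
    (annIdeal_le_monIdeal hS.isUpperSet fun n hn => ⟨_, ?_, 1, fun p => by
      rw [one_mul, lcoeff_apply]⟩) hu ⟨expOf π (a + t) 0 0, ?_,
      monomial_notMem_annIdeal_lcoeff (by simp [exp_le_iff π])⟩ fun n hn => ?_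
  · rw [mem_shiftExponents] at hn
    push Not at hn
    have h1 : n (π 0) < a + t := by
      by_contra! h
      refine hn.1 (by omega) (hU.isUpperSet ?_ ha)
      simp only [exp_le_iff π, expOf_apply_zero, expOf_apply_one, expOf_apply_two,
        Finsupp.tsub_apply]
      omega
    simp only [exp_le_iff π, expOf_apply_zero, expOf_apply_one, expOf_apply_two]
    omega
  · refine mem_shiftExponents.2 (Or.inl ⟨by simp, hU.isUpperSet ?_ ha⟩)
    simp [exp_le_iff π]
  · rcases mem_shiftExponents.1 hn with ⟨h, -⟩ | h
    · exact exists_eq_add_monomial_mul _ (by simpa [exp_le_iff π] using h)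
    · refine ⟨_, monomial_mem_annIdeal_lcoeff ?_, 0, by rw [mul_zero, add_zero]⟩
      simp only [exp_le_iff π, expOf_apply_zero, expOf_apply_one, expOf_apply_two]
      omega

theorem shiftExponents_colon {t B C : ℕ} :
    {n | n + expOf π 0 0 1 ∈ shiftExponents π t B (C + 1) U} =
      shiftExponents π t B C {n | n + expOf π 0 0 1 ∈ U} := by
  ext n
  rw [Set.mem_ofPred_eq, mem_shiftExponents, mem_shiftExponents, Set.mem_ofPred_eq]
  have : n + expOf π 0 0 1 - expOf π t 0 0 = n - expOf π t 0 0 + expOf π 0 0 1 := by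
    apply exp_ext π <;> simp
  rw [this]
  simp

end

/-! ### The six-term inverse system. -/

section

variable {k : Type u} [Field k]

/-- The inverse system of a Gorenstein ideal that lies in `x ^ t * I + (y ^ B, z ^ C)`, where
`t + j = w + C` and `B = w + a`, and agrees with it modulo `z` if the part of `I` without `z` is
generated by `x ^ a, x ^ i * y ^ j, y ^ b`. -/
noncomputable def sixTermFunctional (k : Type u) [Field k] (π : Equiv.Perm (Fin 3))
    (a b i j t w C : ℕ) : MvPolynomial (Fin 3) k →ₗ[k] k :=
  lcoeff k (expOf π (t + a - 1) (j - 1) (C - 1 + t + j + w)) +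
  lcoeff k (expOf π (t - 1) (w + a + j - 1) (C - 1 + t + j)) +
  lcoeff k (expOf π (t - a - 1) (2 * (w + a) + j - 1) (2 * C - 1)) +
  lcoeff k (expOf π (2 * t + a - 1) (2 * j - 1) (C - 1 + w)) +
  lcoeff k (expOf π (2 * t - 1) (w + a + 2 * j - 1) (C - 1)) +
  lcoeff k (expOf π (i - 1) (b - j - 1) (C - 1 + 2 * t + w + a + 3 * j - i - b))

theorem sixTermFunctional_apply {π : Equiv.Perm (Fin 3)} {a b i j t w C : ℕ}
    (p : MvPolynomial (Fin 3) k) :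
    sixTermFunctional k π a b i j t w C p =
      coeff (expOf π (t + a - 1) (j - 1) (C - 1 + t + j + w)) p +
      coeff (expOf π (t - 1) (w + a + j - 1) (C - 1 + t + j)) p +
      coeff (expOf π (t - a - 1) (2 * (w + a) + j - 1) (2 * C - 1)) p +
      coeff (expOf π (2 * t + a - 1) (2 * j - 1) (C - 1 + w)) p +
      coeff (expOf π (2 * t - 1) (w + a + 2 * j - 1) (C - 1)) p +
      coeff (expOf π (i - 1) (b - j - 1) (C - 1 + 2 * t + w + a + 3 * j - i - b)) p := rfl

theorem IsHomogeneousFunctional.add {σ : Type*} {φ ψ : MvPolynomial σ k →ₗ[k] k} {e : ℕ}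
    (hφ : IsHomogeneousFunctional φ e) (hψ : IsHomogeneousFunctional ψ e) :
    IsHomogeneousFunctional (φ + ψ) e := fun n hn => by
  rw [LinearMap.add_apply, hφ n hn, hψ n hn, add_zero]

theorem isHomogeneousFunctional_lcoeff_expOf (π : Equiv.Perm (Fin 3)) {a b c e : ℕ}
    (h : a + b + c = e) : IsHomogeneousFunctional (lcoeff k (expOf π a b c)) e := by
  rw [← h, ← degree_expOf π]
  exact isHomogeneousFunctional_lcoeff _

theorem sub_mem_annIdeal {σ : Type*} {φ : MvPolynomial σ k →ₗ[k] k} {x y : MvPolynomial σ k}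
    (h : ∀ p, φ (x * p) = φ (y * p)) : x - y ∈ annIdeal φ := fun s => by
  rw [mul_sub, map_sub, mul_comm s, h, mul_comm s, sub_self]

section

variable {π : Equiv.Perm (Fin 3)} {a b i j t w C : ℕ} (hi : 0 < i) (hia : i < a) (hj : 0 < j)
  (hjb : j < b) (hC : 0 < C) (hw : 2 * C + 3 * a + 3 * b ≤ w) (ht : t + j = w + C)

include hi hia hj hjb hC hw ht

/-- The relation `t + j = w + C` is what gives all six terms the same degree; the bound on `w`
prevents truncation in the large exponents. -/
theorem isHomogeneousFunctional_sixTerm :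
    IsHomogeneousFunctional (sixTermFunctional k π a b i j t w C)
      (C - 1 + (2 * t - 1) + (w + a + 2 * j - 1)) := by
  refine IsHomogeneousFunctional.add (.add (.add (.add (.add ?_ ?_) ?_) ?_) ?_) ?_ <;>
  · refine isHomogeneousFunctional_lcoeff_expOf π ?_
    omega

/-- In this and the next three binomials, the two monomials contract the first five terms to the
same sums. The sixth term is killed by all eight monomials. Modulo `z` the binomials become the
generators of `x^t (x^a, x^i y^j, y^b) + (y^(w+a))`. -/
theorem xPower_sub_mem_annIdeal_sixTerm :
    monomial (expOf π (t + a) 0 0) (1 : k) - monomial (expOf π 0 (w + a - j) C) 1 ∈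
      annIdeal (sixTermFunctional k π a b i j t w C) := by
  refine sub_mem_annIdeal fun p => ?_
  simp only [sixTermFunctional_apply]
  simp (disch := omega) only [coeff_expOf_mul_eq_zero, coeff_expOf_mul, zero_add, add_zero]
  congr! 3 <;> omega

theorem yPower_sub_mem_annIdeal_sixTerm :
    monomial (expOf π 0 (w + a) 0) (1 : k) - monomial (expOf π a 0 w) 1 ∈
      annIdeal (sixTermFunctional k π a b i j t w C) := by
  refine sub_mem_annIdeal fun p => ?_
  simp only [sixTermFunctional_apply]
  simp (disch := omega) only [coeff_expOf_mul_eq_zero, coeff_expOf_mul, zero_add, add_zero]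
  refine congrArg₂ _ (congrArg₂ _ ?_ ?_) ?_ <;> congr! 2 <;> omega

theorem mixed_sub_mem_annIdeal_sixTerm :
    monomial (expOf π (t + i) j 0) (1 : k) - monomial (expOf π i 0 (t + j)) 1 ∈
      annIdeal (sixTermFunctional k π a b i j t w C) := by
  refine sub_mem_annIdeal fun p => ?_
  simp only [sixTermFunctional_apply]
  simp (disch := omega) only [coeff_expOf_mul_eq_zero, coeff_expOf_mul, zero_add, add_zero]
  congr! 3 <;> omega

theorem inner_sub_mem_annIdeal_sixTerm :
    monomial (expOf π t b 0) (1 : k) - monomial (expOf π 0 (b - j) (t + j)) 1 ∈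
      annIdeal (sixTermFunctional k π a b i j t w C) := by
  refine sub_mem_annIdeal fun p => ?_
  simp only [sixTermFunctional_apply]
  -- The fourth term survives `x^t y^b`, and the first survives `y^(b-j) z^(t+j)`, exactly when `b ≤
  -- 2j - 1`.
  rcases lt_or_ge (2 * j - 1) b with h | h <;>
  simp (disch := omega) only [coeff_expOf_mul_eq_zero, coeff_expOf_mul, zero_add, add_zero]
  · congr! 2 <;> omega
  · congr! 3 <;> omega

/-- The left, right and middle corners are the maximal exponents outside `x^t (x^a, x^i y^j, y^b) +
(y^(w+a), z^C)`. Recovering their coefficients from the functional puts its annihilator inside that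
ideal. -/
theorem coeff_corner_left (p : MvPolynomial (Fin 3) k) :
    coeff (expOf π (t - 1) (w + a - 1) (C - 1)) p =
      sixTermFunctional k π a b i j t w C (monomial (expOf π t (2 * j) 0) 1 * p) := by
  simp only [sixTermFunctional_apply]
  simp (disch := omega) only [coeff_expOf_mul_eq_zero, coeff_expOf_mul, zero_add, add_zero]
  congr! 2 <;> omega

theorem coeff_corner_right (p : MvPolynomial (Fin 3) k) :
    coeff (expOf π (t + a - 1) (j - 1) (C - 1)) p =
      sixTermFunctional k π a b i j t w C (monomial (expOf π t j w) 1 * p) := by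
  simp only [sixTermFunctional_apply]
  simp (disch := omega) only [coeff_expOf_mul_eq_zero, coeff_expOf_mul, zero_add, add_zero]
  congr! 2 <;> omega

/-- The first monomial turns the fifth term into the corner, but leaves a remainder from the second.
The pure power of `z` cancels this remainder by means of the sixth term, which is there for this
purpose. It may also let the first term survive; the monomial with `x^t y^j` cancels that through
the fourth. -/
theorem coeff_corner_middle (p : MvPolynomial (Fin 3) k) :
    coeff (expOf π (t + i - 1) (b - 1) (C - 1)) p =
      sixTermFunctional k π a b i j t w C
        ((monomial (expOf π (t - i) (w + a + 2 * j - b) 0) 1 +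
          (monomial (expOf π t j (w + a + j - i - b)) 1 -
            monomial (expOf π 0 0 (w + a + t + 2 * j - i - b)) 1)) * p) := by
  simp only [add_mul, sub_mul, map_add, map_sub]
  simp only [sixTermFunctional_apply]
  -- The split decides whether the first and fourth terms contribute.
  rcases lt_or_ge (C - 1 + w) (w + a + j - i - b) with h | h <;>
  simp (disch := omega) only [coeff_expOf_mul_eq_zero, coeff_expOf_mul, zero_add, add_zero,
    zero_sub]
  · have key : ∀ x y x' y' : k, x = x' → y = y' → x = y + x' + -y' := by
      rintro x y _ _ rfl rfl; ring
    apply key <;> congr! 2 <;> omega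
  · have key : ∀ x y x' y' v v' : k, x = x' → y = y' → v = v' → x = y + x' + (v - (v' + y')) := by
      rintro x y v _ _ _ rfl rfl rfl; ring
    apply key <;> congr! 2 <;> omega

end

end

/-! ### From `I` to `I : z` with one mixed generator. -/

section

variable {k : Type u} [Field k]

theorem exists_eq_add_of_sub_mem {σ : Type*} {I : Ideal (MvPolynomial σ k)} {m m' n u : σ →₀ ℕ}
    (h : monomial m (1 : k) - monomial m' 1 ∈ I) (hm : m ≤ n) (hu : u ≤ m') :
    ∃ g ∈ I, ∃ p, monomial n (1 : k) = g + monomial u 1 * p := by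
  refine ⟨_, I.mul_mem_right (monomial (n - m) 1) h, monomial (m' - u + (n - m)) 1, ?_⟩
  rw [sub_mul, monomial_mul, monomial_mul, monomial_mul, one_mul, ← add_assoc,
    add_tsub_cancel_of_le hm, add_tsub_cancel_of_le hu, sub_add_cancel]

variable {π : Equiv.Perm (Fin 3)} {U : Set (Fin 3 →₀ ℕ)}

theorem isDoublyLinked_shiftExponents_colon (hU : IsPrimaryExponents U) {a b i j t w C : ℕ}
    (hi : 0 < i) (hia : i < a) (hj : 0 < j) (hjb : j < b) (hC : 1 < C)
    (hw : 2 * C + 3 * a + 3 * b ≤ w) (ht : t + j = w + C)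
    (ha : expOf π a 0 0 ∈ U) (hb : expOf π 0 b 0 ∈ U) (hij : expOf π i j 0 ∈ U)
    (hside : ∀ n ∈ U, n (π 2) = 0 →
      a ≤ n (π 0) ∨ b ≤ n (π 1) ∨ (i ≤ n (π 0) ∧ j ≤ n (π 1))) :
    IsDoublyLinked k (shiftExponents π t (w + a) C U)
      {n | n + expOf π 0 0 1 ∈ shiftExponents π t (w + a) C U} := by
  have hC' : 0 < C := by omega
  have hS : IsPrimaryExponents (shiftExponents π t (w + a) C U) :=
    hU.shiftExponents (by omega) (by omega)
  refine (isHomogeneousFunctional_sixTerm (k := k) (π := π) hi hia hj hjb hC' hw ht).isDoublyLinked hS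
    (annIdeal_le_monIdeal hS.isUpperSet fun n hn => ?_) ?_ ?_ fun n hn => ?_
  · rw [mem_shiftExponents] at hn
    push Not at hn
    obtain ⟨hn0, hn1, hn2⟩ := hn
    rcases lt_or_ge (n (π 0)) t with h | h
    · refine ⟨_, ?_, _, coeff_corner_left hi hia hj hjb hC' hw ht⟩
      simp only [exp_le_iff π, expOf_apply_zero, expOf_apply_one, expOf_apply_two]
      omega
    · have hm := hn0 h
      have hlt : ∀ α β, expOf π α β 0 ∈ U → n (π 0) < t + α ∨ n (π 1) < β := by
        intro α β hαβ
        by_contra! hcon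
        refine hm (hU.isUpperSet ?_ hαβ)
        simp only [exp_le_iff π, expOf_apply_zero, expOf_apply_one, expOf_apply_two,
          Finsupp.tsub_apply]
        omega
      have h1 := hlt _ _ ha
      have h2 := hlt _ _ hb
      rcases hlt _ _ hij with h3 | h3
      · refine ⟨_, ?_, _, coeff_corner_middle hi hia hj hjb hC' hw ht⟩
        simp only [exp_le_iff π, expOf_apply_zero, expOf_apply_one, expOf_apply_two]
        omega
      · refine ⟨_, ?_, _, coeff_corner_right hi hia hj hjb hC' hw ht⟩
        simp only [exp_le_iff π, expOf_apply_zero, expOf_apply_one, expOf_apply_two]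
        omega
  · rw [mem_shiftExponents]
    simp only [expOf_apply_zero, expOf_apply_one, expOf_apply_two]
    omega
  -- This is the fourth term of the functional, on which the functional takes the value 1 by the
  -- right-corner formula.
  · refine ⟨expOf π t j w + expOf π (t + a - 1) (j - 1) (C - 1),
      mem_shiftExponents.2 (Or.inr (Or.inr ?_)), fun hmem => ?_⟩
    · simp only [Finsupp.add_apply, expOf_apply_two]
      omega
    · have h1 := functional_eq_zero_of_mem_annIdeal hmem
      have h2 := coeff_corner_right (π := π) hi hia hj hjb hC' hw ht
        (monomial (expOf π (t + a - 1) (j - 1) (C - 1)) (1 : k))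
      classical
      rw [monomial_mul, one_mul, h1, coeff_monomial, if_pos rfl] at h2
      exact one_ne_zero h2
  · by_cases h0 : n (π 2) = 0
    · rcases mem_shiftExponents.1 hn with ⟨h, hmem⟩ | h | h
      · have := hside _ hmem (by simp [h0])
        simp only [Finsupp.tsub_apply, expOf_apply_zero, expOf_apply_one, tsub_zero] at this
        rcases this with h1 | h1 | h1
        · refine exists_eq_add_of_sub_mem
            (xPower_sub_mem_annIdeal_sixTerm hi hia hj hjb hC' hw ht) (m := expOf π (t + a) 0 0)
            ?_ ?_ <;>
          · simp only [exp_le_iff π, expOf_apply_zero, expOf_apply_one, expOf_apply_two]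
            omega
        · refine exists_eq_add_of_sub_mem
            (inner_sub_mem_annIdeal_sixTerm hi hia hj hjb hC' hw ht) ?_ ?_ <;>
          · simp only [exp_le_iff π, expOf_apply_zero, expOf_apply_one, expOf_apply_two]
            omega
        · refine exists_eq_add_of_sub_mem
            (mixed_sub_mem_annIdeal_sixTerm hi hia hj hjb hC' hw ht) ?_ ?_ <;>
          · simp only [exp_le_iff π, expOf_apply_zero, expOf_apply_one, expOf_apply_two]
            omega
      · refine exists_eq_add_of_sub_mem
          (yPower_sub_mem_annIdeal_sixTerm hi hia hj hjb hC' hw ht) ?_ ?_ <;>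
        · simp only [exp_le_iff π, expOf_apply_zero, expOf_apply_one, expOf_apply_two]
          omega
      · omega
    · apply exists_eq_add_monomial_mul
      simp only [exp_le_iff π, expOf_apply_zero, expOf_apply_one, expOf_apply_two]
      omega

theorem reflTransGen_colon_of_side_eq_three (hU : IsPrimaryExponents U) {a b i j : ℕ}
    (hi : 0 < i) (hia : i < a) (hj : 0 < j) (hjb : j < b)
    (ha : expOf π a 0 0 ∈ U) (hb : expOf π 0 b 0 ∈ U) (hij : expOf π i j 0 ∈ U)
    (hz : expOf π 0 0 1 ∉ U)
    (hside : ∀ n ∈ U, n (π 2) = 0 →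
      a ≤ n (π 0) ∨ b ≤ n (π 1) ∨ (i ≤ n (π 0) ∧ j ≤ n (π 1))) :
    Relation.ReflTransGen (IsDoublyLinked k) U {n | n + expOf π 0 0 1 ∈ U} := by
  obtain ⟨N, hN⟩ := hU.exists_single (π 2)
  rw [single_two_eq] at hN
  -- With `C = N + 2`, both `z^C ∈ I` and `z^(C-1) ∈ I : z` hold and `C > 1`. Then `w` is the least
  -- value allowed and `t` is fixed by homogeneity.
  obtain ⟨w, hw⟩ : ∃ w, w = 2 * (N + 1 + 1) + 3 * a + 3 * b := ⟨_, rfl⟩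
  obtain ⟨t, ht⟩ : ∃ t, t + j = w + (N + 1 + 1) := ⟨w + (N + 1 + 1) - j, by omega⟩
  have hB : expOf π 0 (w + a) 0 ∈ U := hU.isUpperSet (by simp [exp_le_iff π]; omega) hb
  have hle : ∀ n m, n ∈ U → n ≤ m + expOf π 0 0 1 → m ∈ {n | n + expOf π 0 0 1 ∈ U} :=
    fun n m hn hnm => hU.isUpperSet hnm hn
  have h1 : IsDoublyLinked k (shiftExponents π t (w + a) (N + 1 + 1) U) U :=
    isDoublyLinked_shiftExponents hU hB (hU.isUpperSet (by simp [exp_le_iff π]; omega) hN)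
  have h2 : IsDoublyLinked k (shiftExponents π t (w + a) (N + 1 + 1) U) _ :=
    isDoublyLinked_shiftExponents_colon hU hi hia hj hjb (by omega) hw.ge ht ha hb hij hside
  rw [shiftExponents_colon] at h2
  have h3 : IsDoublyLinked k (shiftExponents π t (w + a) (N + 1) {n | n + expOf π 0 0 1 ∈ U}) _ :=
    isDoublyLinked_shiftExponents (hU.colon hz) (hle _ _ hB le_self_add)
      (hle _ _ hN (by simp [exp_le_iff π]; omega))
  exact ((Relation.ReflTransGen.single h1.symm).tail h2).tail h3

end

/-! ### The maximal ideal, numbers of generators, and the induction. -/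

section

variable {k : Type u} [Field k]

theorem isSMulRegular_quotient_span_X {σ : Type*} {S : Set σ} {v : σ} (hv : v ∉ S) :
    IsSMulRegular (MvPolynomial σ k ⧸
      (Ideal.span (X '' S : Set (MvPolynomial σ k)) • ⊤ : Submodule (MvPolynomial σ k) (MvPolynomial σ k)))
      (X v : MvPolynomial σ k) := by
  classical
  rw [isSMulRegular_quotient_iff_mem_of_smul_mem]
  intro p hp
  simp only [smul_eq_mul (a := Ideal.span _), Ideal.mul_top, mem_ideal_span_X_image] at hp ⊢
  intro n hn
  obtain ⟨i, hi, hni⟩ := hp (n + Finsupp.single v 1) (by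
    rw [mem_support_iff, smul_eq_mul, mul_comm, coeff_mul_X]
    exact mem_support_iff.1 hn)
  have : i ≠ v := fun h => hv (h ▸ hi)
  exact ⟨i, hi, by simpa [this] using hni⟩

theorem isCompleteIntersectionIdeal_idealOfVars :
    IsCompleteIntersectionIdeal (idealOfVars (Fin 3) k) := by
  have hspan : idealOfVars (Fin 3) k = Ideal.ofList [X 0, X 1, X 2] := by
    refine congrArg Ideal.span (Set.ext fun p => ?_)
    simp [Fin.exists_fin_succ, eq_comm]
  refine ⟨_, ⟨⟨fun i hi => ?_⟩, ?_⟩, hspan⟩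
  · obtain ⟨S, hS, hvS⟩ : ∃ S : Set (Fin 3), {r : MvPolynomial (Fin 3) k |
        r ∈ [X 0, X 1, X 2].take i} = X '' S ∧ (⟨i, hi⟩ : Fin 3) ∉ S := by
      refine ⟨{v | v.val < i}, Set.ext fun p => ?_, by simp⟩
      simp only [List.length_cons, List.length_nil] at hi
      interval_cases i <;> simp [Fin.exists_fin_succ, eq_comm]
    have h1 := isSMulRegular_quotient_span_X (k := k) hvS
    rw [← hS] at h1
    have h2 : ([X 0, X 1, X 2] : List (MvPolynomial (Fin 3) k))[i] = X ⟨i, hi⟩ := by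
      simp only [List.length_cons, List.length_nil] at hi
      interval_cases i <;> rfl
    rw [h2]
    exact h1
  · rw [← hspan, smul_eq_mul, Ideal.mul_top]
    exact isMaximal_idealOfVars.ne_top.symm

theorem coeff_mul_of_minimal {σ : Type*} {U : Set (σ →₀ ℕ)} (hU : IsUpperSet U) {m : σ →₀ ℕ}
    (hm : Minimal (· ∈ U) m) {p : MvPolynomial σ k} (hp : p ∈ monIdeal k U)
    (r : MvPolynomial σ k) : coeff m (r * p) = coeff 0 r * coeff m p := by
  classical
  rw [coeff_mul]
  refine Finset.sum_eq_single (0, m) ?_ fun h => absurd (by simp) h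
  rintro ⟨a, b⟩ hab hne
  rw [Finset.HasAntidiagonal.mem_antidiagonal] at hab
  by_contra hcon
  have hb : b ∈ U := (mem_monIdeal hU).1 hp b (mem_support_iff.2 (right_ne_zero_of_mul hcon))
  have hbm : b = m := hm.eq_of_le hb (hab ▸ le_add_self)
  subst hbm
  exact hne (by simpa using hab)

/-- Nakayama by hand: reading coefficients at minimal exponents maps the ideal onto `k^T`, and a
ring element acts there through its constant term. Hence ideal generators map to vectors spanning
`k^T`. -/
theorem card_le_spanFinrank {σ : Type*} [Finite σ] {U : Set (σ →₀ ℕ)} (hU : IsUpperSet U)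
    {T : Finset (σ →₀ ℕ)} (hT : ∀ m ∈ T, Minimal (· ∈ U) m) :
    T.card ≤ Submodule.spanFinrank (monIdeal k U) := by
  classical
  obtain ⟨s, hs, hspan⟩ := Submodule.FG.exists_span_finset_card_eq_spanFinrank
    (IsNoetherian.noetherian (monIdeal k U))
  rw [← hs]
  let ev : MvPolynomial σ k →ₗ[k] (T → k) := LinearMap.pi fun m => lcoeff k m.1
  have hev : ∀ p m, ev p m = coeff m.1 p := fun _ _ => rfl
  have key : ∀ p ∈ Submodule.span (MvPolynomial σ k) (s : Set (MvPolynomial σ k)),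
      ev p ∈ Submodule.span k (s.image ev : Set (T → k)) := by
    intro p hp
    induction hp using Submodule.span_induction with
    | mem x hx =>
      refine Submodule.subset_span ?_
      rw [Finset.coe_image]
      exact Set.mem_image_of_mem _ hx
    | zero => rw [map_zero]; exact Submodule.zero_mem _
    | add x y _ _ hx hy => rw [map_add]; exact Submodule.add_mem _ hx hy
    | smul r x hx ih =>
      have : ev (r • x) = coeff 0 r • ev x := by
        funext m
        rw [Pi.smul_apply, hev, hev, smul_eq_mul, smul_eq_mul,
          coeff_mul_of_minimal hU (hT _ m.2) (hspan ▸ hx)]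
      rw [this]
      exact Submodule.smul_mem _ _ ih
  have htop : Submodule.span k (s.image ev : Set (T → k)) = ⊤ := by
    rw [eq_top_iff, ← (Pi.basisFun k T).span_eq, Submodule.span_le]
    rintro _ ⟨m, rfl⟩
    have h1 : monomial m.1 (1 : k) ∈ monIdeal k U :=
      (monomial_mem_monIdeal hU).2 (hT _ m.2).prop
    rw [← hspan] at h1
    have h2 : ev (monomial m.1 1) = Pi.basisFun k T m := by
      funext m'
      rw [hev, coeff_monomial, Pi.basisFun_apply, Pi.single_apply]
      simp only [Subtype.ext_iff, eq_comm]
    rw [← h2]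
    exact key _ h1
  calc T.card = Module.finrank k (T → k) := by simp
    _ = (s.image ev : Set (T → k)).finrank k := by
      rw [Set.finrank, htop, finrank_top]
    _ ≤ (s.image ev).card := finrank_span_finset_le_card _
    _ ≤ s.card := Finset.card_image_le

theorem exists_finset_card_le {σ : Type*} [Finite σ] {U : Set (σ →₀ ℕ)} (hU : IsUpperSet U) :
    ∃ T : Finset (σ →₀ ℕ), T.card ≤ Submodule.spanFinrank (monIdeal k U) ∧
      ∀ n, n ∈ U ↔ ∃ m ∈ T, m ≤ n := by
  have hfin : {m | Minimal (· ∈ U) m}.Finite := by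
    by_contra hinf
    obtain ⟨T, hT, hcard⟩ := Set.Infinite.exists_subset_card_eq hinf
      (Submodule.spanFinrank (monIdeal k U) + 1)
    have := card_le_spanFinrank (k := k) hU (T := T) fun m hm => hT hm
    omega
  refine ⟨hfin.toFinset, card_le_spanFinrank hU fun m hm => by simpa using hm, fun n => ?_⟩
  constructor
  · intro hn
    obtain ⟨m, hmn, hm⟩ := exists_minimal_le_of_wellFoundedLT (· ∈ U) n hn
    exact ⟨m, by simpa using hm, hmn⟩
  · rintro ⟨m, hm, hmn⟩
    have hm' : Minimal (· ∈ U) m := by simpa using hm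
    exact hU hmn hm'.prop

theorem exists_third (v w : Fin 3) : ∃ x, x ≠ v ∧ x ≠ w := by
  revert v w; decide

/-- Among at most eight exponents that generate, some pair of variables has at most one
generator involving exactly these two variables. -/
theorem exists_card_mixed_le_one {T : Finset (Fin 3 →₀ ℕ)} (hT : T.card ≤ 8) {N : Fin 3 → ℕ}
    (hN : ∀ v, N v ≠ 0) (hNT : ∀ v, Finsupp.single v (N v) ∈ T) :
    ∃ v, (T.filter fun m => m v = 0 ∧ ∀ w, w ≠ v → m w ≠ 0).card ≤ 1 := by
  classical
  by_contra! hcon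
  -- One pure power and at least two mixed generators per variable: three disjoint sets of size at
  -- least three inside `T`.
  let F : Fin 3 → Finset (Fin 3 →₀ ℕ) := fun v =>
    insert (Finsupp.single v (N v)) (T.filter fun m => m v = 0 ∧ ∀ w, w ≠ v → m w ≠ 0)
  have hF : ∀ v, 3 ≤ (F v).card := by
    intro v
    have h : Finsupp.single v (N v) ∉
        T.filter fun m => m v = 0 ∧ ∀ w, w ≠ v → m w ≠ 0 := by
      simp [hN v]
    have := hcon v
    change 3 ≤ (insert _ _ : Finset _).card
    rw [Finset.card_insert_of_notMem h]
    omega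
  have hne : ∀ v w, v ≠ w → Finsupp.single v (N v) ∉ F w := by
    intro v w hvw hmem
    rcases Finset.mem_insert.1 hmem with h | h
    · have := DFunLike.congr_fun h v
      simp [hvw, hN v] at this
    · obtain ⟨x, hx, hxw⟩ := exists_third v w
      exact (Finset.mem_filter.1 h).2.2 x hxw (by simp [hx.symm])
  have hdisj : ∀ v w, v ≠ w → Disjoint (F v) (F w) := by
    intro v w hvw
    rw [Finset.disjoint_left]
    intro m hmv hmw
    rcases Finset.mem_insert.1 hmv with rfl | h
    · exact hne v w hvw hmw
    rcases Finset.mem_insert.1 hmw with rfl | h'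
    · exact hne w v hvw.symm hmv
    · exact (Finset.mem_filter.1 h').2.2 v hvw (Finset.mem_filter.1 h).2.1
  have hsub : Finset.univ.biUnion F ⊆ T := by
    intro m hm
    obtain ⟨v, -, hv⟩ := Finset.mem_biUnion.1 hm
    rcases Finset.mem_insert.1 hv with rfl | h
    · exact hNT v
    · exact (Finset.mem_filter.1 h).1
  have h1 := Finset.card_le_card hsub
  rw [Finset.card_biUnion fun v _ w _ hvw => hdisj v w hvw, Fin.sum_univ_three] at h1
  have := hF 0
  have := hF 1
  have := hF 2
  omega

theorem exists_reflTransGen_colon {U : Set (Fin 3 →₀ ℕ)} (hU : IsPrimaryExponents U)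
    {T : Finset (Fin 3 →₀ ℕ)} (hT : T.card ≤ 8) (hTU : ∀ n, n ∈ U ↔ ∃ m ∈ T, m ≤ n)
    (hne : ∃ v, Finsupp.single v 1 ∉ U) :
    ∃ v, Finsupp.single v 1 ∉ U ∧
      Relation.ReflTransGen (IsDoublyLinked k) U {n | n + Finsupp.single v 1 ∈ U} := by
  classical
  let N : Fin 3 → ℕ := fun v => Nat.find (hU.exists_single v)
  have hNU : ∀ v, Finsupp.single v (N v) ∈ U := fun v => Nat.find_spec (hU.exists_single v)
  have hNle : ∀ v M, Finsupp.single v M ∈ U → N v ≤ M := fun v M h => Nat.find_min' _ h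
  have hN0 : ∀ v, N v ≠ 0 := by
    intro v h
    have := hNU v
    rw [h, Finsupp.single_zero] at this
    exact hU.zero_notMem this
  have hNT : ∀ v, Finsupp.single v (N v) ∈ T := by
    intro v
    obtain ⟨m, hm, hle⟩ := (hTU _).1 (hNU v)
    have hms : m = Finsupp.single v (m v) := by
      ext w
      rcases eq_or_ne v w with rfl | hvw
      · simp
      · have := Finsupp.le_def.1 hle w
        simpa [hvw, Finsupp.single_apply] using this
    have h1 : N v ≤ m v := hNle v _ (hms ▸ (hTU m).2 ⟨m, hm, le_rfl⟩)
    have h2 : m = Finsupp.single v (N v) := by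
      refine le_antisymm hle ?_
      rwa [Finsupp.single_le_iff]
    exact h2 ▸ hm
  -- The variable found by counting might lie in `I`. If some variable `w` lies in `I`, any `v`
  -- outside `I` serves instead: every mixed generator without `v` is a multiple of `w`, hence
  -- redundant.
  obtain ⟨v, hv, hgood⟩ : ∃ v, Finsupp.single v 1 ∉ U ∧
      ((T.filter fun m => m v = 0 ∧ ∀ w, w ≠ v → m w ≠ 0).card ≤ 1 ∨ ∃ w, w ≠ v ∧ N w = 1) := by
    by_cases h1 : ∃ w, Finsupp.single w 1 ∈ U
    · obtain ⟨w, hw⟩ := h1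
      obtain ⟨v, hv⟩ := hne
      refine ⟨v, hv, Or.inr ⟨w, fun h => hv (h ▸ hw), ?_⟩⟩
      have := hNle w 1 hw
      have := hN0 w
      omega
    · push Not at h1
      obtain ⟨v, hv⟩ := exists_card_mixed_le_one hT hN0 hNT
      exact ⟨v, h1 v, Or.inl hv⟩
  refine ⟨v, hv, ?_⟩
  obtain ⟨π, rfl⟩ : ∃ π : Equiv.Perm (Fin 3), π 2 = v := ⟨Equiv.swap 2 v, by simp⟩
  have ha := hNU (π 0)
  have hb := hNU (π 1)
  rw [single_zero_eq] at ha
  rw [single_one_eq] at hb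
  rw [single_two_eq] at hv ⊢
  have hside : ∀ n ∈ U, n (π 2) = 0 → N (π 0) ≤ n (π 0) ∨ N (π 1) ≤ n (π 1) ∨
      ∃ m ∈ T.filter fun m => m (π 2) = 0 ∧ ∀ w, w ≠ π 2 → m w ≠ 0, m ≤ n := by
    intro n hn hn2
    obtain ⟨m, hm, hle⟩ := (hTU n).1 hn
    have hmU := (hTU m).2 ⟨m, hm, le_rfl⟩
    have hle' := (exp_le_iff π).1 hle
    have hm2 : m (π 2) = 0 := by omega
    by_cases h0 : m (π 0) = 0
    · right; left
      have : m = Finsupp.single (π 1) (m (π 1)) := by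
        rw [single_one_eq]; apply exp_ext π <;> simp [h0, hm2]
      exact (hNle _ _ (this ▸ hmU)).trans hle'.2.1
    by_cases h1 : m (π 1) = 0
    · left
      have : m = Finsupp.single (π 0) (m (π 0)) := by
        rw [single_zero_eq]; apply exp_ext π <;> simp [h1, hm2]
      exact (hNle _ _ (this ▸ hmU)).trans hle'.1
    · refine Or.inr (Or.inr ⟨m, Finset.mem_filter.2 ⟨hm, hm2, ?_⟩, hle⟩)
      rw [forall_perm_fin_three π]
      exact ⟨fun _ => h0, fun _ => h1, fun h => absurd rfl h⟩
  -- `T` need not be minimal, so a mixed generator may be a multiple of a pure power; if all are,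
  -- two generators suffice modulo `z`.
  by_cases hred : ∀ m ∈ T.filter fun m => m (π 2) = 0 ∧ ∀ w, w ≠ π 2 → m w ≠ 0,
      N (π 0) ≤ m (π 0) ∨ N (π 1) ≤ m (π 1)
  · refine .single (isDoublyLinked_of_side_eq_two hU ha hb hv fun n hn hn2 => ?_)
    rcases hside n hn hn2 with h | h | ⟨m, hm, hle⟩
    · exact Or.inl h
    · exact Or.inr h
    · have hle' := (exp_le_iff π).1 hle
      exact (hred m hm).imp (fun h => h.trans hle'.1) fun h => h.trans hle'.2.1
  · push Not at hred
    obtain ⟨m, hm, hm0, hm1⟩ := hred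
    obtain ⟨hmT, hm2, hmne⟩ := Finset.mem_filter.1 hm
    have hp0 : m (π 0) ≠ 0 := hmne _ (by simp)
    have hp1 : m (π 1) ≠ 0 := hmne _ (by simp)
    have hcard : (T.filter fun m => m (π 2) = 0 ∧ ∀ w, w ≠ π 2 → m w ≠ 0).card ≤ 1 := by
      refine hgood.resolve_right ?_
      rintro ⟨w, hw, hw1⟩
      obtain ⟨x, rfl⟩ := π.surjective w
      fin_cases x
      · change N (π 0) = 1 at hw1
        omega
      · change N (π 1) = 1 at hw1
        omega
      · exact hw rfl
    have hmeq : m = expOf π (m (π 0)) (m (π 1)) 0 := by apply exp_ext π <;> simp [hm2]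
    refine reflTransGen_colon_of_side_eq_three hU (Nat.pos_of_ne_zero hp0) hm0
      (Nat.pos_of_ne_zero hp1) hm1 ha hb (hmeq ▸ (hTU m).2 ⟨m, hmT, le_rfl⟩) hv
      fun n hn hn2 => ?_
    refine (hside n hn hn2).imp_right (Or.imp_right ?_)
    rintro ⟨m', hm', hle⟩
    rw [Finset.card_le_one.1 hcard m' hm' m hm] at hle
    have hle' := (exp_le_iff π).1 hle
    exact ⟨hle'.1, hle'.2.1⟩

theorem reflTransGen_idealOfVars {U : Set (Fin 3 →₀ ℕ)} (hU : IsPrimaryExponents U)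
    {T : Finset (Fin 3 →₀ ℕ)} (hT : T.card ≤ 8) (hTU : ∀ n, n ∈ U ↔ ∃ m ∈ T, m ≤ n) :
    ∃ V, IsPrimaryExponents V ∧ monIdeal k V = idealOfVars (Fin 3) k ∧
      Relation.ReflTransGen (IsDoublyLinked k) U V := by
  classical
  obtain ⟨I, hI⟩ : ∃ I, I = monIdeal k U := ⟨_, rfl⟩
  induction I using WellFoundedGT.induction generalizing U T with
  | _ I ih =>
    by_cases hne : ∃ v, Finsupp.single v 1 ∉ U
    · obtain ⟨v, hv, hlink⟩ := exists_reflTransGen_colon (k := k) hU hT hTU hne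
      have hV := hU.colon hv
      have hlt : monIdeal k U < monIdeal k {n | n + Finsupp.single v 1 ∈ U} := by
        have hle : U ⊆ {n | n + Finsupp.single v 1 ∈ U} :=
          fun n hn => hU.isUpperSet le_self_add hn
        refine lt_of_le_of_ne (Ideal.span_mono (Set.image_mono hle)) fun heq => ?_
        have hfind := Nat.find_spec (hU.exists_single v)
        have hpos : Nat.find (hU.exists_single v) ≠ 0 := by
          intro h
          rw [h, Finsupp.single_zero] at hfind
          exact hU.zero_notMem hfind
        -- The inclusion is strict because the least power of the variable in the ideal drops by
        -- one.
        refine Nat.find_min (hU.exists_single v) (Nat.sub_one_lt hpos) ?_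
        rw [← monomial_mem_monIdeal (k := k) hU.isUpperSet, heq,
          monomial_mem_monIdeal hV.isUpperSet, Set.mem_ofPred_eq, ← Finsupp.single_add]
        rwa [Nat.sub_add_cancel (Nat.one_le_iff_ne_zero.2 hpos)]
      -- Truncated subtraction of the variable from each exponent generates the colon, so the number
      -- of generators does not grow.
      obtain ⟨W, hW, hWeq, hchain⟩ := ih _ (hI ▸ hlt) hV
        (T := T.image (· - Finsupp.single v 1)) (Finset.card_image_le.trans hT) (fun n => by
          simp only [Set.mem_ofPred_eq, hTU, Finset.exists_mem_image, tsub_le_iff_right]) rfl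
      exact ⟨W, hW, hWeq, hlink.trans hchain⟩
    · push Not at hne
      refine ⟨U, hU, le_antisymm hU.monIdeal_le ?_, .refl⟩
      refine Ideal.span_le.2 ?_
      rintro _ ⟨v, rfl⟩
      exact (monomial_mem_monIdeal hU.isUpperSet).2 (hne v)

theorem exists_isPrimaryExponents {σ : Type*} {I : Ideal (MvPolynomial σ k)}
    (hprimary : IsVarsPrimary I) (hmonomial : IsMonomialIdeal I) :
    ∃ U, IsPrimaryExponents U ∧ I = monIdeal k U := by
  obtain ⟨S, rfl⟩ := hmonomial
  have hupper : IsUpperSet {n | ∃ m ∈ S, m ≤ n} :=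
    fun a b hab ⟨m, hm, hma⟩ => ⟨m, hm, hma.trans hab⟩
  have heq : Ideal.span ((fun a => monomial a (1 : k)) '' S) =
      monIdeal k {n | ∃ m ∈ S, m ≤ n} := by
    ext p
    rw [mem_ideal_span_monomial_image, mem_monIdeal hupper]
    rfl
  rw [heq] at hprimary
  refine ⟨_, ⟨hupper, fun h => ?_, fun i => ?_⟩, heq⟩
  · refine hprimary.1.ne_top ((Ideal.eq_top_iff_one _).2 ?_)
    exact (monomial_mem_monIdeal hupper).2 h
  · have hX : (X i : MvPolynomial σ k) ∈ idealOfVars σ k := Ideal.subset_span ⟨i, rfl⟩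
    rw [← hprimary.2] at hX
    obtain ⟨N, hN⟩ := hX
    rw [X_pow_eq_monomial] at hN
    exact ⟨N, (monomial_mem_monIdeal hupper).1 hN⟩

end

end

theorem theorem3p1 {k : Type u} [Field k] (I : Ideal (MvPolynomial (Fin 3) k))
    (hprimary : IsVarsPrimary I) (hmonomial : IsMonomialIdeal I)
    (hgen : Submodule.spanFinrank I ≤ 8) :
    IsHomogeneouslyGlicci I ∧
      ∃ (s : ℕ) (L : ℕ → Ideal (MvPolynomial (Fin 3) k)),
        IsHomogeneousGlicciChain I (2 * s) L ∧
          ∀ j ≤ s, IsVarsPrimary (L (2 * j)) ∧ IsMonomialIdeal (L (2 * j)) := by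
  obtain ⟨U, hU, rfl⟩ := exists_isPrimaryExponents hprimary hmonomial
  obtain ⟨T, hT, hTU⟩ := exists_finset_card_le (k := k) hU.isUpperSet
  obtain ⟨V, hV, hVeq, hchain⟩ := reflTransGen_idealOfVars (k := k) hU (hT.trans hgen) hTU
  obtain ⟨s, L, hL, hmon⟩ := exists_chain_of_reflTransGen hchain hV
    (hVeq ▸ isCompleteIntersectionIdeal_idealOfVars)
  exact ⟨⟨_, L, hL⟩, s, L, hL, hmon⟩
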